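/- **Vocabulary and structures.** Let $\tau$ have unary predicates $P_0,P_1,P_2,P_4$, a binary relation $R$, the Boolean operations, order and constants $\wedge,\vee,{}^-,\le,0,1$ (on $P_1$), a unary function $G_1:P_0\to P_1$ and unary functions $F_n:P_2\to P_1$ ($n<\omega$). We consider $\tau$-structures $M$ whose universe is partitioned by $P_0^M,P_1^M,P_2^M$, in which $P_1^M$ is a Boolean algebra, $P_4^M\subseteq P_1^M$ and $R^M\subseteq P_0^M\times P_1^M$. Substructures are subsets closed under all functions and constants, with the induced relations. Let $P^M_{4,n}$ be the set of joins of $n$ distinct atoms of $P_1^M$; so $P_{4,1}^M$ is the set of atoms. Let $K^{-1}_{<\aleph_0}$ be the class of finitely generated $M$ such that: (i) $b\mapsto R(M,b)=\{a: R^M(a,b)\}$ is a Boolean algebra homomorphism $P_1^M\to\mathcal P(P_0^M)$; (ii) $P_4^M=\bigcup_n P_{4,n}^M$, and $P_4^M=\{c: c\le b_*\}$ for some $b_*\in P_1^M$; (iii) $G_1^M$ is a bijection from $P_0^M$ onto $P_{4,1}^M$ with $R(M,G_1^M(a))=\{a\}$; (iv) $P_2^M$ is finite; (v) for all $a\in P^M_{4,1}$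 and $c\in P_2^M$, $a\not\le F_n^M(c)$ for all but finitely many $n$; (vi) $P_1^M$ is generated as a Boolean algebra by $P_4^M\cup\{F_n^M(c):c\in P_2^M,n<\omega\}\cup X$ for some finite $X$. Let $K_{-1}$ be the class of structures $M$ such that every finite subset of $M$ is contained in a finitely generated substructure of $M$ that belongs to $K^{-1}_{<\aleph_0}$. A structure $M\in K_{-1}$ is *$P_0$-maximal* if $M\subseteq N\in K_{-1}$ implies $P_0^N=P_0^M$. Let $\mathrm{uf}(M)$ be the set of ultrafilters $D$ of $P_1^M$ with $D\cap P_{4,1}^M=\emptyset$ such that for each $c\in P_2^M$ the set $\{n:F_n^M(c)\in D\}$ is finite. For an infinite cardinal $\lambda$, $M$ is *nicely free* (in $\lambda$) if $|P_1^M|=\lambda$ and there is a family $\langle b_\alpha:\alpha<\lambda\rangle$ in $P_1^M\setminus P_4^M$ such that $\langle b_\alpha/P_4^M:\alpha<\lambda\rangle$ freely generates $P_1^M/P_4^M$, and a set $Y\subseteq P_2^M$ with $|Y|=\lambda$ such that the elements $F_n^M(c)$ ($n<\omega$, $c\in Y$) are pairwise distinct and all belong to $\{b_\alpha:\alpha<\lambda\}$.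 **Theorem.** Let $\lambda=2^\mu$ for some infinite cardinal $\mu$, and suppose $\lambda$ is less than the first measurable cardinal (that is, less than every uncountable measurable cardinal; no condition if there is none). Then there is a $P_0$-maximal $M_*\in K_{-1}$ such that $|P_0^{M_*}|=|P_1^{M_*}|=|P_2^{M_*}|=\lambda$, $P_1^{M_*}$ is an atomic Boolean algebra, $\mathrm{uf}(M_*)=\emptyset$, and $M_*$ is nicely free in $\lambda$. -/

import Mathlib

universe u

/-- A cardinal is measurable if it is uncountable and carries a non-principal ultrafilter that is
closed under intersections of fewer than `κ` sets. -/
def IsMeasurableCardinal (κ : Cardinal.{u}) : Prop :=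
  Cardinal.aleph0 < κ ∧
    ∃ (α : Type u) (D : Ultrafilter α), Cardinal.mk α = κ ∧
      (∀ a : α, ({a} : Set α) ∉ D) ∧ CardinalInterFilter (D : Filter α) κ

/-- `lam` is below the first measurable cardinal (no condition if there is none). -/
def BelowFirstMeasurable (lam : Cardinal.{u}) : Prop :=
  ∀ κ : Cardinal.{u}, IsMeasurableCardinal κ → lam < κ

/-- Boolean polynomials (terms) in variables indexed by `ι`. -/
inductive BoolPoly (ι : Type u) : Type u
  | var : ι → BoolPoly ι
  | zero : BoolPoly ι
  | one : BoolPoly ι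
  | meet : BoolPoly ι → BoolPoly ι → BoolPoly ι
  | join : BoolPoly ι → BoolPoly ι → BoolPoly ι
  | neg : BoolPoly ι → BoolPoly ι

/-- Evaluation of a Boolean polynomial in a Boolean algebra. -/
def BoolPoly.eval {ι : Type u} {B : Type*} [BooleanAlgebra B] (v : ι → B) : BoolPoly ι → B
  | .var i => v i
  | .zero => ⊥
  | .one => ⊤
  | .meet p q => p.eval v ⊓ q.eval v
  | .join p q => p.eval v ⊔ q.eval v
  | .neg p => (p.eval v)ᶜ

/-- A Boolean polynomial is non-trivial if it is not identically `0`; it is enough to look at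
assignments into the two-element Boolean algebra. -/
def BoolPoly.Nontrivial {ι : Type u} (p : BoolPoly ι) : Prop :=
  ∃ v : ι → Bool, p.eval v ≠ ⊥

/-- The family `b` is independent modulo `I`: no non-trivial Boolean polynomial in distinct members
of the family takes a value in `I`. -/
def IndependentMod {ι : Type u} {B : Type u} [BooleanAlgebra B] (I : Set B) (b : ι → B) : Prop :=
  ∀ p : BoolPoly ι, p.Nontrivial → p.eval b ∉ I

/-- The classes modulo the ideal `I` of the family `b` generate the quotient of `B` by `I`
freely: every element is, up to a symmetric difference in `I`, a Boolean polynomial in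
the family, and the family is independent modulo `I`. -/
def FreelyGeneratesMod {ι : Type u} {B : Type u} [BooleanAlgebra B] (I : Set B) (b : ι → B) :
    Prop :=
  (∀ x : B, ∃ p : BoolPoly ι, symmDiff x (p.eval b) ∈ I) ∧ IndependentMod I b

/-- An ultrafilter of a Boolean algebra. -/
structure IsBAUltrafilter {B : Type u} [BooleanAlgebra B] (D : Set B) : Prop where
  top_mem : ⊤ ∈ D
  bot_notMem : ⊥ ∉ D
  mem_of_le : ∀ a b : B, a ∈ D → a ≤ b → b ∈ D
  inf_mem : ∀ a b : B, a ∈ D → b ∈ D → a ⊓ b ∈ D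
  mem_or_compl_mem : ∀ a : B, a ∈ D ∨ aᶜ ∈ D

/-- Structures for the vocabulary with unary predicates `P0`, `P1`, `P2`, `P4`, a binary relation
`R`, the Boolean operations on `P1`, and unary functions `G` and `F n`, in which `P0`, `P1`, `P2`
partition the universe (the three sorts), `P1` is a Boolean algebra, `P4` is a subset of `P1`,
`R` is a subset of `P0 × P1`, `G` maps `P0` to `P1` and each `F n` maps `P2` to `P1`. -/
structure TauStr : Type (u + 1) where
  P0 : Type u
  P1 : Type u
  P2 : Type u
  [ba : BooleanAlgebra P1]
  P4 : Set P1
  R : P0 → P1 → Prop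
  G : P0 → P1
  F : ℕ → P2 → P1

attribute [instance] TauStr.ba

namespace TauStr

/-- Substructures: subsets of the three sorts closed under all functions and constants. -/
structure Sub (M : TauStr.{u}) where
  S0 : Set M.P0
  S1 : BooleanSubalgebra M.P1
  S2 : Set M.P2
  G_mem : ∀ a ∈ S0, M.G a ∈ S1
  F_mem : ∀ (n : ℕ), ∀ c ∈ S2, M.F n c ∈ S1

/-- `S` contains the given subsets of the three sorts. -/
def Sub.Contains {M : TauStr.{u}} (S : M.Sub) (A0 : Set M.P0) (A1 : Set M.P1) (A2 : Set M.P2) :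
    Prop :=
  A0 ⊆ S.S0 ∧ A1 ⊆ (S.S1 : Set M.P1) ∧ A2 ⊆ S.S2

/-- A substructure, as a structure with the induced predicates, relation and functions. -/
def Sub.toStr {M : TauStr.{u}} (S : M.Sub) : TauStr.{u} where
  P0 := S.S0
  P1 := S.S1
  P2 := S.S2
  P4 := {b | (b : M.P1) ∈ M.P4}
  R := fun a b => M.R a b
  G := fun a => ⟨M.G a, S.G_mem a a.2⟩
  F := fun n c => ⟨M.F n c, S.F_mem n c c.2⟩

/-- `M` is finitely generated: some finite subset of `M` lies in no proper substructure. -/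
def IsFG (M : TauStr.{u}) : Prop :=
  ∃ (A0 : Set M.P0) (A1 : Set M.P1) (A2 : Set M.P2), A0.Finite ∧ A1.Finite ∧ A2.Finite ∧
    ∀ S : M.Sub, S.Contains A0 A1 A2 → S.Contains Set.univ Set.univ Set.univ

/-- The set `P_{4,n}` of joins of `n` distinct atoms of `P1`. -/
def P4n (M : TauStr.{u}) (n : ℕ) : Set M.P1 :=
  {b | ∃ s : Finset M.P1, s.card = n ∧ (∀ x ∈ s, IsAtom x) ∧ b = s.sup id}

/-- The class of finitely generated structures from which the class `K_{-1}` is built. -/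
structure IsKFin (M : TauStr.{u}) : Prop where
  fg : M.IsFG
  /-- `b ↦ R(M, b)` is a homomorphism from `P1` to the power set of `P0`. -/
  R_hom : ∃ f : BoundedLatticeHom M.P1 (Set M.P0), ∀ b, f b = {a | M.R a b}
  /-- `P4` is the set of all finite joins of atoms. -/
  P4_eq : M.P4 = ⋃ n, M.P4n n
  P4_principal : ∃ bstar : M.P1, M.P4 = {c | c ≤ bstar}
  G_bij : Set.BijOn M.G Set.univ (M.P4n 1)
  R_G : ∀ a : M.P0, {a' | M.R a' (M.G a)} = {a}
  P2_finite : Finite M.P2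
  /-- Countable incompleteness. -/
  incomplete : ∀ a ∈ M.P4n 1, ∀ c : M.P2, {n : ℕ | a ≤ M.F n c}.Finite
  generated : ∃ X : Set M.P1, X.Finite ∧
    BooleanSubalgebra.closure (M.P4 ∪ {b | ∃ n c, b = M.F n c} ∪ X) = ⊤

/-- The class `K_{-1}`: every finite subset of `M` is contained in a finitely generated
substructure of `M` which belongs to the class above. -/
def IsK (M : TauStr.{u}) : Prop :=
  ∀ (A0 : Set M.P0) (A1 : Set M.P1) (A2 : Set M.P2), A0.Finite → A1.Finite → A2.Finite →
    ∃ S : M.Sub, S.Contains A0 A1 A2 ∧ S.toStr.IsKFin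

/-- Embeddings of structures. -/
structure Emb (M N : TauStr.{u}) where
  e0 : M.P0 → N.P0
  e1 : BoundedLatticeHom M.P1 N.P1
  e2 : M.P2 → N.P2
  inj0 : Function.Injective e0
  inj1 : Function.Injective e1
  inj2 : Function.Injective e2
  map_P4 : ∀ b, e1 b ∈ N.P4 ↔ b ∈ M.P4
  map_R : ∀ a b, N.R (e0 a) (e1 b) ↔ M.R a b
  map_G : ∀ a, e1 (M.G a) = N.G (e0 a)
  map_F : ∀ n c, e1 (M.F n c) = N.F n (e2 c)

/-- `M` is a `P0`-maximal member of `K_{-1}`: no extension of `M` in `K_{-1}` has a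
larger `P0`. -/
def IsP0Maximal (M : TauStr.{u}) : Prop :=
  M.IsK ∧ ∀ N : TauStr.{u}, N.IsK → ∀ e : Emb M N, Function.Surjective e.e0

/-- The set `uf(M)` of ultrafilters of `P1` that contain no atom and, for each `c`, only finitely
many (indices `n`) of the `F n c`. -/
def uf (M : TauStr.{u}) : Set (Set M.P1) :=
  {D | IsBAUltrafilter D ∧ D ∩ M.P4n 1 = ∅ ∧ ∀ c : M.P2, {n : ℕ | M.F n c ∈ D}.Finite}

/-- `M` is nicely free (in cardinality `lam`). -/
def IsNicelyFree (M : TauStr.{u}) (lam : Cardinal.{u}) : Prop :=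
  Cardinal.mk M.P1 = lam ∧
    ∃ (ι : Type u) (b : ι → M.P1), Cardinal.mk ι = lam ∧
      (∀ i, b i ∉ M.P4) ∧
      FreelyGeneratesMod M.P4 b ∧
      ∃ Y : Set M.P2, Cardinal.mk Y = lam ∧
        (∀ c ∈ Y, ∀ n : ℕ, M.F n c ∈ Set.range b) ∧
        (∀ c ∈ Y, ∀ c' ∈ Y, ∀ n n' : ℕ, M.F n c = M.F n' c' → c = c' ∧ n = n')

end TauStr

open Set Filter Cardinal

/-! Let the points be the subsets of a well-ordered set `m` of size `mu`. `P1` is an algebra of sets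
of points, generated modulo finite sets by an independent family, and `P4` consists of the finite
sets. A new point in an extension would trace a member of `uf` on `P1`, so maximality follows from
`uf = ∅` (`isP0Maximal_of_uf_eq_empty`).

To empty `uf`, `P2` contains, besides sequences of generators, every countable sequence of literals
whose intersection lies in a finite set `f`; its `F n` is the intersection of the literals up to the
`n`-th, minus `f`. Hence if `D ∈ uf`, every countable part of the pattern of `D` on generators is
realized by a point outside any given finite set (`setStr.exists_realized`). The generators code the
coordinate sets and, for a point `q` and `s ⊆ m`, the set of points whose first difference with `q`
lies in `s`. The pattern on coordinates defines a `q`, and first differences with this `q` show that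
the selected `s` form a countably complete nonprincipal ultrafilter on `m`
(`exists_ultrafilter_of_realized`). That yields a measurable cardinal at most `mu`, a contradiction.

The coding sets are not independent. Each is replaced by infinitely many copies, every point being
altered in finitely many generators only: this gives independence (`finitelyDense_gen`) and
preserves eventual membership (`eventually_mem_gen_iff`). -/

/-- A countably complete ultrafilter without singletons on a type yields a measurable cardinal
bounded by the cardinality of the type. -/
theorem exists_isMeasurableCardinal_le {m : Type u} (U : Ultrafilter m)
    (hU : ∀ A : ℕ → Set m, (∀ k, A k ∈ U) → (⋂ k, A k) ∈ U)
    (hsing : ∀ i : m, ({i} : Set m) ∉ U) :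
    ∃ κ : Cardinal.{u}, IsMeasurableCardinal κ ∧ κ ≤ #m := by
  classical
  let C : Set Cardinal.{u} :=
    {c | ∃ (ι : Type u) (A : ι → Set m), #ι = c ∧ (∀ i, A i ∈ U) ∧ (⋂ i, A i) ∉ U}
  have hmC : #m ∈ C := by
    refine ⟨m, fun i => {i}ᶜ, rfl, fun i => Ultrafilter.compl_mem_iff_notMem.2 (hsing i), ?_⟩
    have : (⋂ i : m, ({i} : Set m)ᶜ) = ∅ := by
      ext x; simp
    rw [this]
    exact U.empty_notMem
  have hCne : C.Nonempty := ⟨_, hmC⟩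
  obtain ⟨ι, A, hι, hA, hAn⟩ := csInf_mem hCne
  have hmin : ∀ (J : Type u) (B : J → Set m), #J < sInf C → (∀ j, B j ∈ U) → (⋂ j, B j) ∈ U := by
    intro J B hJ hB
    by_contra hcon
    exact absurd (csInf_le' (s := C) ⟨J, B, rfl, hB, hcon⟩) (not_le.2 hJ)
  refine ⟨sInf C, ⟨?_, ?_⟩, csInf_le' hmC⟩
  · by_contra hle
    rw [not_lt, ← hι, mk_le_aleph0_iff] at hle
    apply hAn
    rcases isEmpty_or_nonempty ι with he | hne
    · rw [iInter_of_empty]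
      exact univ_mem
    · obtain ⟨f, hf⟩ := exists_surjective_nat ι
      rw [← hf.iInter_comp]
      exact hU _ fun k => hA _
  · have hne : Nonempty ι := by
      by_contra he
      rw [not_nonempty_iff] at he
      exact hAn (by rw [iInter_of_empty]; exact univ_mem)
    -- Send `x` to an index whose set omits it. The default value is used only on `⋂ i, A i`, which
    -- is not in `U`. Off that set the fibre over `i` misses `A i`, so no singleton is large in the
    -- image.
    let h : m → ι := fun x => if hx : ∃ i, x ∉ A i then hx.choose else Classical.arbitrary ι
    have hh : ∀ x, x ∉ (⋂ i, A i) → x ∉ A (h x) := by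
      intro x hx
      have hx' : ∃ i, x ∉ A i := by simpa using hx
      simp only [h, dif_pos hx']
      exact hx'.choose_spec
    refine ⟨ι, U.map h, hι, fun i hi => ?_, ⟨fun S hS hmem => ?_⟩⟩
    · rw [Ultrafilter.mem_map] at hi
      have h1 := Ultrafilter.compl_mem_iff_notMem.2 hAn
      refine U.empty_notMem (mem_of_superset (inter_mem (inter_mem hi (hA i)) h1) ?_)
      rintro x ⟨⟨hx1, hx2⟩, hx3⟩
      simp only [mem_preimage, mem_singleton_iff] at hx1
      exact hh x hx3 (hx1 ▸ hx2)
    · rw [sInter_eq_iInter]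
      change (h ⁻¹' _) ∈ U
      rw [preimage_iInter]
      exact hmin _ _ hS fun j => hmem _ j.2

/-! ### Extensions and maximality -/

namespace TauStr

theorem Sub.exists_hom {N : TauStr.{u}} {S : N.Sub} (hS : S.toStr.IsKFin) :
    ∃ f : BoundedLatticeHom S.S1 (Set S.S0), ∀ z a, a ∈ f z ↔ N.R a z := by
  obtain ⟨f, hf⟩ := hS.R_hom
  exact ⟨f, fun z a => Set.ext_iff.1 (hf z) a⟩

theorem Sub.rel_G_iff {N : TauStr.{u}} {S : N.Sub} (hS : S.toStr.IsKFin) (a a' : S.S0) :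
    N.R a' (N.G a) ↔ a' = a :=
  Set.ext_iff.1 (hS.R_G a) a'

/-- `G a` is an atom, so it lies below `b` or below `bᶜ`; the latter would put `a` in the complement
of the set attached to `b`. -/
theorem Sub.rel_G_le {N : TauStr.{u}} {S : N.Sub} (hS : S.toStr.IsKFin) {a : S.S0} {b : S.S1}
    (hR : N.R a b) : S.toStr.G a ≤ b := by
  obtain ⟨f, hf⟩ := Sub.exists_hom hS
  have hat : IsAtom (α := S.S1) ⟨N.G a, S.G_mem a a.2⟩ := by
    obtain ⟨s, hs, hs1, hs2⟩ := hS.G_bij.mapsTo (mem_univ a)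
    obtain ⟨x, rfl⟩ := Finset.card_eq_one.1 hs
    rw [Finset.sup_singleton] at hs2
    have := hs1 x (by simp)
    rw [← show S.toStr.G a = x from hs2] at this
    exact this
  rcases hat.le_iff.1 (inf_le_left : _ ⊓ b ≤ _) with h | h
  swap
  · exact inf_eq_left.1 h
  · have h := le_compl_iff_disjoint_right.2 (disjoint_iff.2 h)
    have h1 : a ∈ f bᶜ := OrderHomClass.mono f h ((hf _ _).2 ((Sub.rel_G_iff hS a a).2 rfl))
    rw [map_compl'] at h1
    exact absurd ((hf _ _).2 hR) h1

/-- The elements of `P1` related to a fixed element of `P0` in an extension form an ultrafilter. -/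
theorem isBAUltrafilter_rel {M N : TauStr.{u}} (hN : N.IsK) (e : Emb M N) (a : N.P0) :
    IsBAUltrafilter {b : M.P1 | N.R a (e.e1 b)} := by
  have key : ∀ b b' : M.P1, ∃ (S : N.Sub) (f : BoundedLatticeHom S.S1 (Set S.S0)) (h0 : a ∈ S.S0),
      e.e1 b ∈ S.S1 ∧ e.e1 b' ∈ S.S1 ∧ ∀ z : S.S1, N.R a z ↔ ⟨a, h0⟩ ∈ f z := by
    intro b b'
    obtain ⟨S, ⟨h0, h1, h2⟩, hS⟩ := hN {a} {e.e1 b, e.e1 b'} ∅ (by simp) (by simp) (by simp)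
    obtain ⟨f, hf⟩ := Sub.exists_hom hS
    exact ⟨S, f, h0 rfl, h1 (by simp), h1 (by simp), fun z => (hf z ⟨a, h0 rfl⟩).symm⟩
  constructor
  · obtain ⟨S, f, h0, -, -, hf⟩ := key ⊤ ⊤
    have := (hf ⊤).2 (by simp)
    simpa using this
  · obtain ⟨S, f, h0, -, -, hf⟩ := key ⊤ ⊤
    intro h
    have h' : N.R a ((⊥ : S.S1) : N.P1) := by simpa using h
    have := (hf ⊥).1 h'
    simp at this
  · intro b b' hb hbb'
    obtain ⟨S, f, h0, h1, h2, hf⟩ := key b b'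
    have h3 := (hf ⟨_, h1⟩).1 hb
    have h4 : (⟨_, h1⟩ : S.S1) ≤ ⟨_, h2⟩ := (OrderHomClass.mono e.e1 hbb' : e.e1 b ≤ e.e1 b')
    exact (hf ⟨_, h2⟩).2 (OrderHomClass.mono f h4 h3)
  · intro b b' hb hb'
    obtain ⟨S, f, h0, h1, h2, hf⟩ := key b b'
    have h3 := (hf ⟨_, h1⟩).1 hb
    have h4 := (hf ⟨_, h2⟩).1 hb'
    have := (hf (⟨_, h1⟩ ⊓ ⟨_, h2⟩)).2 (by rw [InfHomClass.map_inf]; exact ⟨h3, h4⟩)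
    simpa using this
  · intro b
    obtain ⟨S, f, h0, h1, h2, hf⟩ := key b b
    have h3 : (⟨a, h0⟩ : S.S0) ∈ f ⟨_, h1⟩ ∨ (⟨a, h0⟩ : S.S0) ∈ f (⟨_, h1⟩ᶜ) := by
      rw [map_compl']
      exact em _
    refine h3.imp (fun h => (hf ⟨_, h1⟩).2 h) fun h => ?_
    have := (hf _).2 h
    simpa [map_compl'] using this

/-- For a new point `a`, the trace ultrafilter contains no atom, since being related to `G` of an
old point means being that point. It contains `F n c` only when `G a` lies below it, hence for
finitely many `n`. -/
theorem isP0Maximal_of_uf_eq_empty {M : TauStr.{u}} (hM : M.IsK)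
    (hG : ∀ b ∈ M.P4n 1, ∃ a, M.G a = b) (huf : M.uf = ∅) : M.IsP0Maximal := by
  refine ⟨hM, fun N hN e a => ?_⟩
  by_contra hne
  have hmem : {b : M.P1 | N.R a (e.e1 b)} ∈ M.uf := by
    refine ⟨isBAUltrafilter_rel hN e a, ?_, fun c => ?_⟩
    · rw [eq_empty_iff_forall_notMem]
      rintro b ⟨hb, hb1⟩
      obtain ⟨a', rfl⟩ := hG b hb1
      apply hne
      refine ⟨a', ?_⟩
      obtain ⟨S, ⟨h0, h1, h2⟩, hS⟩ := hN {a, e.e0 a'} ∅ ∅ (by simp) (by simp) (by simp)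
      have hb' : N.R a (N.G (e.e0 a')) := e.map_G a' ▸ hb
      exact (congrArg Subtype.val
        ((Sub.rel_G_iff hS ⟨e.e0 a', h0 (by simp)⟩ ⟨a, h0 (by simp)⟩).1 hb')).symm
    · obtain ⟨S, ⟨h0, h1, h2⟩, hS⟩ := hN {a} ∅ {e.e2 c} (by simp) (by simp) (by simp)
      refine (hS.incomplete _ (hS.G_bij.mapsTo (mem_univ ⟨a, h0 rfl⟩)) ⟨e.e2 c, h2 rfl⟩).subset ?_
      intro n hn
      have hn' : N.R a (e.e1 (M.F n c)) := hn
      rw [e.map_F] at hn'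
      exact Sub.rel_G_le hS (a := ⟨a, h0 rfl⟩) (b := ⟨N.F n (e.e2 c), S.F_mem n _ (h2 rfl)⟩) hn'
  rw [huf] at hmem
  exact hmem

end TauStr

theorem BooleanSubalgebra.closure_subtype_eq_top {B : Type*} [BooleanAlgebra B] {s : Set B}
    {t : Set (closure s)} (h : ∀ z : closure s, z.1 ∈ s → z ∈ t) : closure t = ⊤ := by
  rw [eq_top_iff]
  have h1 : closure s ≤ (closure t).map (closure s).subtype :=
    closure_le.2 fun x hx => ⟨⟨x, subset_closure hx⟩, subset_closure (h _ hx), rfl⟩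
  intro z _
  obtain ⟨z', hz', hzz'⟩ := h1 z.2
  rwa [← Subtype.ext hzz']

/-! ### Boolean terms: evaluation, support, counting -/

namespace BoolPoly

variable {ι X : Type u}

theorem mem_eval_iff (b : ι → Set X) (a : X) (v : ι → Bool) (hv : ∀ i, a ∈ b i ↔ v i = true)
    (p : BoolPoly ι) : a ∈ p.eval b ↔ p.eval v = true := by
  induction p with
  | var i => exact hv i
  | zero => simp [eval]
  | one => simp [eval]
  | meet p q hp hq => simp [eval, hp, hq]
  | join p q hp hq => simp [eval, hp, hq]
  | neg p hp => simp [eval, hp]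

theorem exists_support (p : BoolPoly ι) :
    ∃ J : Finset ι, ∀ v v' : ι → Bool, (∀ i ∈ J, v i = v' i) → p.eval v = p.eval v' := by
  classical
  induction p with
  | var i => exact ⟨{i}, fun v v' h => h i (by simp)⟩
  | zero => exact ⟨∅, fun _ _ _ => rfl⟩
  | one => exact ⟨∅, fun _ _ _ => rfl⟩
  | meet p q hp hq =>
    obtain ⟨J, hJ⟩ := hp
    obtain ⟨J', hJ'⟩ := hq
    exact ⟨J ∪ J', fun v v' h => congrArg₂ (· ⊓ ·)
      (hJ v v' fun i hi => h i (by simp [hi])) (hJ' v v' fun i hi => h i (by simp [hi]))⟩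
  | join p q hp hq =>
    obtain ⟨J, hJ⟩ := hp
    obtain ⟨J', hJ'⟩ := hq
    exact ⟨J ∪ J', fun v v' h => congrArg₂ (· ⊔ ·)
      (hJ v v' fun i hi => h i (by simp [hi])) (hJ' v v' fun i hi => h i (by simp [hi]))⟩
  | neg p hp =>
    obtain ⟨J, hJ⟩ := hp
    exact ⟨J, fun v v' h => congrArg compl (hJ v v' h)⟩

theorem map_eval {A B : Type*} [BooleanAlgebra A] [BooleanAlgebra B] (f : BoundedLatticeHom A B)
    (v : ι → A) (p : BoolPoly ι) : f (p.eval v) = p.eval (fun i => f (v i)) := by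
  induction p with
  | var i => rfl
  | zero => simp [eval]
  | one => simp [eval]
  | meet p q hp hq => simp [eval, hp, hq]
  | join p q hp hq => simp [eval, hp, hq]
  | neg p hp => simp [eval, hp]

/-- Prefix notation for terms. -/
def toList : BoolPoly ι → List (ι ⊕ Fin 5)
  | .var i => [.inl i]
  | .zero => [.inr 0]
  | .one => [.inr 1]
  | .meet p q => .inr 2 :: (p.toList ++ q.toList)
  | .join p q => .inr 3 :: (p.toList ++ q.toList)
  | .neg p => .inr 4 :: p.toList

/-- The tails `l`, `l'` let the induction cancel the first argument of a binary operation before the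
second. -/
theorem toList_append_inj (p q : BoolPoly ι) (l l' : List (ι ⊕ Fin 5))
    (h : p.toList ++ l = q.toList ++ l') : p = q ∧ l = l' := by
  induction p generalizing q l l' with
  | var i => cases q <;> simp_all [toList]
  | zero => cases q <;> simp_all [toList]
  | one => cases q <;> simp_all [toList]
  | meet p p' hp hp' =>
    cases q <;> simp [toList] at h
    obtain ⟨rfl, h1⟩ := hp _ _ _ h
    obtain ⟨rfl, h2⟩ := hp' _ _ _ h1
    exact ⟨rfl, h2⟩
  | join p p' hp hp' =>
    cases q <;> simp [toList] at h
    obtain ⟨rfl, h1⟩ := hp _ _ _ h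
    obtain ⟨rfl, h2⟩ := hp' _ _ _ h1
    exact ⟨rfl, h2⟩
  | neg p hp =>
    cases q <;> simp [toList] at h
    obtain ⟨rfl, h1⟩ := hp _ _ _ h
    exact ⟨rfl, h1⟩

theorem mk_le (hι : ℵ₀ ≤ #ι) : #(BoolPoly ι) ≤ #ι := by
  have h1 : #(BoolPoly ι) ≤ #(List (ι ⊕ Fin 5)) :=
    mk_le_of_injective (f := toList) fun p q h => (toList_append_inj p q [] [] (by simp [h])).1
  refine h1.trans ((mk_list_le_max _).trans ?_)
  simp only [mk_sum, mk_fin, lift_natCast, lift_uzero]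
  exact max_le hι (add_le_of_le hι le_rfl ((natCast_lt_aleph0 (n := 5)).le.trans hι))

end BoolPoly

/-! ### Independent families and the algebras they generate modulo finite sets -/

/-- Every finite pattern of membership in the sets `b i` is realized infinitely often. -/
def FinitelyDense {X ι : Type u} (b : ι → Set X) : Prop :=
  ∀ (J : Finset ι) (v : ι → Bool), {a | ∀ i ∈ J, a ∈ b i ↔ v i = true}.Infinite

variable {X ι Y : Type u} {b : ι → Set X}

theorem FinitelyDense.eval_infinite (hb : FinitelyDense b) {p : BoolPoly ι} (hp : p.Nontrivial) :
    (p.eval b).Infinite := by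
  classical
  obtain ⟨v, hv⟩ := hp
  obtain ⟨J, hJ⟩ := p.exists_support
  refine (hb J v).mono fun a ha => ?_
  rw [p.mem_eval_iff b a (fun i => decide (a ∈ b i)) (by simp),
    hJ _ v fun i hi => by rw [Bool.eq_iff_iff]; simpa using ha i hi]
  simpa using hv

theorem BoolPoly.nontrivial_of_mem_eval {p : BoolPoly ι} {a : X} (ha : a ∈ p.eval b) :
    p.Nontrivial := by
  classical
  refine ⟨fun i => decide (a ∈ b i), ?_⟩
  have := (p.mem_eval_iff b a (fun i => decide (a ∈ b i)) (by simp)).1 ha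
  rw [this]
  simp

/-- A generator outside the support of `p` can be prescribed either way without affecting the value
of `p`. -/
theorem FinitelyDense.exists_split (hb : FinitelyDense b) {p : BoolPoly ι} {a : X}
    (ha : a ∈ p.eval b) :
    ∃ J : Finset ι, ∀ i ∉ J, (p.eval b ∩ b i).Infinite ∧ (p.eval b \ b i).Infinite := by
  classical
  obtain ⟨v, hv⟩ := p.nontrivial_of_mem_eval ha
  obtain ⟨J, hJ⟩ := p.exists_support
  refine ⟨J, fun i hi => ?_⟩
  have key : ∀ ε, (p.eval b ∩ {x | x ∈ b i ↔ ε = true}).Infinite := by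
    intro ε
    refine (hb (insert i J) (Function.update v i ε)).mono fun x hx => ?_
    have hxi := hx i (by simp)
    refine ⟨?_, by simpa using hxi⟩
    rw [p.mem_eval_iff b x (fun i => decide (x ∈ b i)) (by simp), hJ _ v fun j hj => ?_]
    · simpa using hv
    · have hji : j ≠ i := fun h => hi (h ▸ hj)
      have := hx j (by simp [hj])
      rw [Function.update_of_ne hji] at this
      rw [Bool.eq_iff_iff]
      simpa using this
  refine ⟨(key true).mono ?_, (key false).mono ?_⟩
  · rintro x ⟨h1, h2⟩
    exact ⟨h1, h2.2 rfl⟩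
  · rintro x ⟨h1, h2⟩
    exact ⟨h1, fun h => by simpa using h2.1 h⟩

/-- The sets which agree with a Boolean polynomial in the sets `b i` eventually along `l`. -/
def polyAlg (b : ι → Set X) (l : Filter X) : BooleanSubalgebra (Set X) where
  carrier := {x | ∃ p : BoolPoly ι, x =ᶠ[l] p.eval b}
  supClosed' := by
    rintro x ⟨p, hp⟩ y ⟨q, hq⟩
    exact ⟨.join p q, hp.union hq⟩
  infClosed' := by
    rintro x ⟨p, hp⟩ y ⟨q, hq⟩
    exact ⟨.meet p q, hp.inter hq⟩
  compl_mem' := by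
    rintro x ⟨p, hp⟩
    exact ⟨.neg p, hp.compl⟩
  bot_mem' := ⟨.zero, EventuallyEq.rfl⟩

theorem gen_mem_polyAlg (l : Filter X) (i : ι) : b i ∈ polyAlg b l :=
  ⟨.var i, EventuallyEq.rfl⟩

theorem mem_polyAlg_of_eventuallyEq {l : Filter X} {x y : Set X} (h : x =ᶠ[l] y)
    (hy : y ∈ polyAlg b l) : x ∈ polyAlg b l := by
  obtain ⟨p, hp⟩ := hy
  exact ⟨p, h.trans hp⟩

theorem finite_mem_polyAlg {x : Set X} (hx : x.Finite) : x ∈ polyAlg b cofinite := by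
  refine ⟨.zero, ?_⟩
  filter_upwards [hx.compl_mem_cofinite] with a ha
  exact propext ⟨fun h => ha h, fun h => h.elim⟩

/-- A generator or its complement. -/
def literal (b : ι → Set X) (s : ι × Bool) : Set X := {a | a ∈ b s.1 ↔ s.2 = true}

theorem literal_mem_polyAlg (l : Filter X) (s : ι × Bool) : literal b s ∈ polyAlg b l := by
  obtain ⟨i, _ | _⟩ := s
  · have : literal b (i, false) = (b i)ᶜ := by ext; simp [literal]
    rw [this]
    exact BooleanSubalgebra.compl_mem (gen_mem_polyAlg l i)
  · have : literal b (i, true) = b i := by ext; simp [literal]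
    rw [this]
    exact gen_mem_polyAlg l i

/-- The intersection of the first literals of a sequence. -/
def initInter (b : ι → Set X) (s : ℕ → ι × Bool) (n : ℕ) : Set X :=
  {a | ∀ k ≤ n, a ∈ literal b (s k)}

theorem initInter_mem_polyAlg (l : Filter X) (s : ℕ → ι × Bool) (n : ℕ) :
    initInter b s n ∈ polyAlg b l := by
  induction n with
  | zero =>
    have : initInter b s 0 = literal b (s 0) := by ext; simp [initInter]
    rw [this]
    exact literal_mem_polyAlg l _
  | succ n ih =>
    have : initInter b s (n + 1) = initInter b s n ∩ literal b (s (n + 1)) := by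
      ext a
      simp [initInter, Nat.le_succ_iff, or_imp, forall_and]
    rw [this]
    exact BooleanSubalgebra.inf_mem ih (literal_mem_polyAlg l _)

/-- The sequences of literals whose intersection is covered by a given finite set. -/
def LiteralSeq (b : ι → Set X) : Type u :=
  {c : (ℕ → ι × Bool) × Finset X // ∀ a, (∀ k, a ∈ literal b (c.1 k)) → a ∈ c.2}

/-- The finite set of points removed from the `F n c`. -/
def exceptional (c : Y ⊕ LiteralSeq b) : Finset X := c.elim (fun _ => ∅) fun c => c.1.2

/-- The sets `F n c`. -/
def fam (seq : Y → ℕ → ι) (n : ℕ) (c : Y ⊕ LiteralSeq b) : Set X :=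
  c.elim (fun y => b (seq y n)) fun c => initInter b c.1.1 n \ c.1.2

/-- One finite error set serves all `n` at once; this keeps the errors uniform in a substructure
containing every `F n c`. -/
theorem fam_mem_polyAlg_principal (seq : Y → ℕ → ι) (n : ℕ) (c : Y ⊕ LiteralSeq b) {T : Set X}
    (hT : (exceptional c : Set X) ⊆ T) : fam seq n c ∈ polyAlg b (𝓟 Tᶜ) := by
  rcases c with y | c
  · exact gen_mem_polyAlg _ _
  · refine mem_polyAlg_of_eventuallyEq ?_ (initInter_mem_polyAlg _ c.1.1 n)
    filter_upwards [mem_principal_self Tᶜ] with a ha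
    exact propext ⟨fun h => h.1, fun h => ⟨h, fun h' => ha (hT h')⟩⟩

theorem polyAlg_principal_le {T : Set X} (hT : T.Finite) :
    polyAlg b (𝓟 Tᶜ) ≤ polyAlg b cofinite := by
  rintro x ⟨p, hp⟩
  exact ⟨p, hp.filter_mono (le_principal_iff.2 hT.compl_mem_cofinite)⟩

theorem fam_mem_polyAlg (seq : Y → ℕ → ι) (n : ℕ) (c : Y ⊕ LiteralSeq b) :
    fam seq n c ∈ polyAlg b cofinite :=
  polyAlg_principal_le (exceptional c).finite_toSet (fam_mem_polyAlg_principal seq n c le_rfl)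

theorem exists_finite_mem_polyAlg_principal {x : Set X} (hx : x ∈ polyAlg b cofinite) :
    ∃ T : Set X, T.Finite ∧ ∀ T', T ⊆ T' → x ∈ polyAlg b (𝓟 T'ᶜ) := by
  obtain ⟨p, hp⟩ := hx
  refine ⟨_, hp, fun T' hT' => ⟨p, ?_⟩⟩
  filter_upwards [mem_principal_self T'ᶜ] with a ha
  by_contra hcon
  exact ha (hT' hcon)

/-- A point of the finite set has been removed; any other point fails some literal `k` and so leaves
all intersections from `k` on. -/
theorem fam_finite {seq : Y → ℕ → ι} (hseq : ∀ a y, {n | a ∈ b (seq y n)}.Finite) (a : X)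
    (c : Y ⊕ LiteralSeq b) : {n | a ∈ fam seq n c}.Finite := by
  rcases c with y | c
  · exact hseq a y
  · by_cases ha : a ∈ c.1.2
    · convert finite_empty (α := ℕ)
      ext n
      simp only [mem_ofPred_eq, mem_empty_iff_false, iff_false]
      exact fun h => h.2 ha
    · obtain ⟨k, hk⟩ : ∃ k, a ∉ literal b (c.1.1 k) := by
        by_contra hcon
        push Not at hcon
        exact ha (c.2 a hcon)
      refine (finite_lt_nat k).subset fun n hn => ?_
      by_contra hkn
      exact hk (hn.1 k (not_lt.1 hkn))

/-! ### The structure of an independent family -/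

/-- The structure on the sets which agree with a polynomial in the `b i` up to a finite set. -/
abbrev setStr (b : ι → Set X) (seq : Y → ℕ → ι) : TauStr.{u} where
  P0 := X
  P1 := polyAlg b cofinite
  P2 := Y ⊕ LiteralSeq b
  P4 := {x | x.1.Finite}
  R := fun a x => a ∈ x.1
  G := fun a => ⟨{a}, finite_mem_polyAlg (finite_singleton a)⟩
  F := fun n c => ⟨fam seq n c, fam_mem_polyAlg seq n c⟩

theorem TauStr.mem_P4n_one {M : TauStr.{u}} {x : M.P1} : x ∈ M.P4n 1 ↔ IsAtom x := by
  constructor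
  · rintro ⟨t, ht, ht1, rfl⟩
    obtain ⟨x, rfl⟩ := Finset.card_eq_one.1 ht
    simpa using ht1
  · exact fun h => ⟨{x}, by simp, by simpa using h, by simp⟩

namespace setStr

variable {seq : Y → ℕ → ι}

/-- A criterion for a substructure with finitely many points and sequences to belong to the
class of finitely generated structures. -/
theorem isKFin_toStr (hseq : ∀ a y, {n | a ∈ b (seq y n)}.Finite)
    {A : Set (polyAlg b cofinite)} (hA : A.Finite) {T : Set X} (hT : T.Finite)
    {C : Set (Y ⊕ LiteralSeq b)} (hC : C.Finite) (S : (setStr b seq).Sub) (h0 : S.S0 = T)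
    (h1 : S.S1 = BooleanSubalgebra.closure
      ((setStr b seq).G '' T ∪ {x | ∃ n, ∃ c ∈ C, x = (setStr b seq).F n c} ∪ A))
    (h2 : S.S2 = C)
    (hfin : ∀ z : S.S1, z.1.1.Finite → z.1.1 ⊆ T)
    (hat : ∀ z : S.S1, IsAtom z → z.1.1.Finite) : S.toStr.IsKFin := by
  classical
  obtain ⟨S0, S1, S2, hG, hF⟩ := S
  dsimp only at h0 h1 h2
  subst h0 h1 h2
  set s := (setStr b seq).G '' S0 ∪ {x | ∃ n, ∃ c ∈ S2, x = (setStr b seq).F n c} ∪ A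
  let P := BooleanSubalgebra.closure s
  change ∀ z : P, _ at hfin hat
  let sg : S0 → P := fun a => ⟨(setStr b seq).G a, hG a a.2⟩
  have hsg : Function.Injective sg := by
    intro a a' h
    have h' : ({a.1} : Set X) = {a'.1} := congrArg (fun z : P => z.1.1) h
    exact Subtype.ext (singleton_injective h')
  have hsgat : ∀ a, IsAtom (sg a) := by
    refine fun a => ⟨fun h => ?_, fun z hz => ?_⟩
    · have h' : ({a.1} : Set X) = ∅ := congrArg (fun z : P => z.1.1) h
      exact singleton_ne_empty _ h'
    · have h' : z.1.1 ⊂ {a.1} := hz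
      exact Subtype.ext (Subtype.ext (ssubset_singleton_iff.1 h'))
  have hatsg : ∀ z : P, IsAtom z → ∃ a, sg a = z := by
    intro z hz
    have hne : z.1.1.Nonempty := by
      by_contra hcon
      exact hz.1 (Subtype.ext (Subtype.ext (not_nonempty_iff_eq_empty.1 hcon)))
    obtain ⟨a, ha⟩ := hne
    refine ⟨⟨a, hfin z (hat z hz) ha⟩, ?_⟩
    refine (hz.le_iff.1 ?_).resolve_left (hsgat _).1
    exact singleton_subset_iff.2 ha
  have hsup : ∀ t : Finset S0, (t.image sg).sup id ∈ {z : P | z.1.1 = Subtype.val '' (t : Set S0)} := by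
    intro t
    induction t using Finset.induction_on with
    | empty => simp
    | insert a t _ ih =>
      rw [Finset.image_insert, Finset.sup_insert]
      simp only [mem_ofPred_eq] at ih ⊢
      change {a.1} ∪ ((t.image sg).sup id).1.1 = _
      rw [ih]
      rw [Finset.coe_insert, image_insert_eq]
      rfl
  have hP4 : ∀ z : P, z.1.1.Finite → ∃ t : Finset P, (∀ x ∈ t, IsAtom x) ∧ z = t.sup id := by
    intro z hz
    suffices ∃ t : Finset S0, z = (t.image sg).sup id by
      obtain ⟨t, ht⟩ := this
      refine ⟨t.image sg, fun x hx => ?_, ht⟩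
      obtain ⟨a, -, rfl⟩ := Finset.mem_image.1 hx
      exact hsgat a
    refine ⟨(hz.subset (t := (Subtype.val '' (Subtype.val ⁻¹' z.1.1 : Set S0)))
      (image_preimage_subset _ _)).of_finite_image Subtype.val_injective.injOn |>.toFinset, ?_⟩
    apply Subtype.ext
    apply Subtype.ext
    rw [hsup]
    simpa [Subtype.image_preimage_coe] using (hfin z hz)
  have hgen : BooleanSubalgebra.closure ({z : P | z.1.1.Finite} ∪
      {z : P | ∃ n, ∃ c : S2, z = ⟨(setStr b seq).F n c, hF n c c.2⟩} ∪ {z | z.1 ∈ A}) = ⊤ := by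
    refine BooleanSubalgebra.closure_subtype_eq_top ?_
    rintro z ((⟨a, -, ha⟩ | ⟨n, c, hc, hz⟩) | hz)
    · refine Or.inl (Or.inl ?_)
      change z.1.1.Finite
      rw [← ha]
      exact finite_singleton a
    · exact Or.inl (Or.inr ⟨n, ⟨c, hc⟩, Subtype.ext hz⟩)
    · exact Or.inr hz
  have hA' : {z : P | z.1 ∈ A}.Finite := hA.preimage Subtype.val_injective.injOn
  have hS0 : Finite S0 := hT
  have hS2 : Finite S2 := hC
  constructor
  · refine ⟨univ, {z : P | z.1 ∈ A}, univ, finite_univ (α := S0), hA', finite_univ (α := S2), ?_⟩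
    rintro S' ⟨h0, h1, h2⟩
    refine ⟨h0, ?_, h2⟩
    have : (⊤ : BooleanSubalgebra P) ≤ S'.S1 := by
      rw [← BooleanSubalgebra.closure_subtype_eq_top (s := s) (t := {z | z ∈ S'.S1}) ?_]
      · exact BooleanSubalgebra.closure_le.2 le_rfl
      · rintro z ((⟨a, ha, haz⟩ | ⟨n, c, hc, hz⟩) | hz)
        · have : z = sg ⟨a, ha⟩ := Subtype.ext haz.symm
          rw [this]
          exact S'.G_mem _ (h0 (mem_univ (⟨a, ha⟩ : S0)))
        · have : z = ⟨(setStr b seq).F n c, hF n c hc⟩ := Subtype.ext hz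
          rw [this]
          exact S'.F_mem n _ (h2 (mem_univ (⟨c, hc⟩ : S2)))
        · exact h1 hz
    exact fun z _ => this (mem_univ z)
  · exact ⟨{ toFun := fun z : P => {a : S0 | a.1 ∈ z.1.1}
             map_sup' := fun _ _ => rfl
             map_inf' := fun _ _ => rfl
             map_top' := rfl
             map_bot' := rfl }, fun _ => rfl⟩
  · apply Set.ext
    intro z
    rw [mem_iUnion]
    constructor
    · intro hz
      obtain ⟨t, ht⟩ := hP4 z hz
      exact ⟨_, t, rfl, ht⟩
    · rintro ⟨n, t, -, ht, rfl⟩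
      refine Finset.sup_induction (p := fun z : P => z.1.1.Finite) ?_ ?_ fun x hx => hat x (ht x hx)
      · exact finite_empty
      · exact fun _ h _ h' => h.union h'
  · have := Fintype.ofFinite S0
    -- The bound is the set of all points of the substructure, which contains every finite element
    -- by `hfin`.
    refine ⟨((Finset.univ : Finset S0).image sg).sup id, ?_⟩
    have hu := hsup Finset.univ
    apply Set.ext
    intro z
    change z.1.1.Finite ↔ z.1.1 ⊆ (((Finset.univ : Finset S0).image sg).sup id : P).1.1
    rw [hu]
    simp only [Finset.coe_univ, image_univ, Subtype.range_coe_subtype, ofPred_mem_eq]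
    exact ⟨fun h => hfin z h, fun h => Set.Finite.subset hT h⟩
  · refine ⟨fun a _ => ?_, fun a _ a' _ h => hsg h, ?_⟩
    · exact TauStr.mem_P4n_one.2 (hsgat a)
    · intro z hz
      obtain ⟨a, rfl⟩ := hatsg z (TauStr.mem_P4n_one.1 hz)
      exact ⟨a, mem_univ a, rfl⟩
  · intro a
    apply Set.ext
    intro a'
    exact mem_singleton_iff.trans Subtype.ext_iff.symm
  · exact hS2
  · intro z hz c
    obtain ⟨a, rfl⟩ := hatsg z (TauStr.mem_P4n_one.1 hz)
    exact (fam_finite hseq a.1 c.1).subset fun n hn => (hn : {a.1} ⊆ fam seq n c.1) rfl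
  · exact ⟨{z : P | z.1 ∈ A}, hA', hgen⟩

/-- Enlarge the given finite sets so that every element of the generated algebra is a polynomial off
one finite set `T`. By density a finite element stays inside `T`, and an infinite one splits. -/
theorem isK (hb : FinitelyDense b) (hseq : ∀ a y, {n | a ∈ b (seq y n)}.Finite)
    (hinj : ∀ y, Function.Injective (seq y)) [Nonempty Y] : (setStr b seq).IsK := by
  classical
  intro A0 A1 A2 hA0 hA1 hA2
  let y0 : Y := Classical.arbitrary Y
  choose d hd hd' using fun x : polyAlg b cofinite => exists_finite_mem_polyAlg_principal x.2
  let T : Set X := A0 ∪ (⋃ x ∈ A1, d x) ∪ ⋃ c ∈ A2, (exceptional c : Set X)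
  have hT : T.Finite := (hA0.union (hA1.biUnion fun x _ => hd x)).union
    (hA2.biUnion fun c _ => Finset.finite_toSet _)
  -- The extra sequence `y0` supplies infinitely many generators, one of which lies outside the
  -- finite set given by `exists_split`; so no atom is infinite.
  let C : Set (Y ⊕ LiteralSeq b) := insert (.inl y0) A2
  have hC : C.Finite := hA2.insert _
  let s := (setStr b seq).G '' T ∪ {x | ∃ n, ∃ c ∈ C, x = (setStr b seq).F n c} ∪ A1
  let S : (setStr b seq).Sub :=
    { S0 := T
      S1 := BooleanSubalgebra.closure s
      S2 := C
      G_mem := fun a ha => BooleanSubalgebra.subset_closure (Or.inl (Or.inl ⟨a, ha, rfl⟩))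
      F_mem := fun n c hc => BooleanSubalgebra.subset_closure (Or.inl (Or.inr ⟨n, c, hc, rfl⟩)) }
  have hclos : ∀ z ∈ BooleanSubalgebra.closure s, z.1 ∈ polyAlg b (𝓟 Tᶜ) := by
    have : BooleanSubalgebra.closure s ≤
        (polyAlg b (𝓟 Tᶜ)).comap (polyAlg b cofinite).subtype := by
      refine BooleanSubalgebra.closure_le.2 ?_
      rintro z ((⟨a, ha, rfl⟩ | ⟨n, c, hc, rfl⟩) | hz)
      · refine ⟨.zero, ?_⟩
        filter_upwards [mem_principal_self Tᶜ] with x hx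
        exact propext ⟨fun h => hx ((mem_singleton_iff.1 h) ▸ ha), fun h => h.elim⟩
      · refine fam_mem_polyAlg_principal seq n c ?_
        rcases hc with rfl | hc
        · simp [exceptional]
        · exact (subset_biUnion_of_mem (u := fun c => (exceptional c : Set X)) hc).trans
            subset_union_right
      · exact hd' z T ((subset_biUnion_of_mem (u := d) hz).trans
          (subset_union_right.trans subset_union_left))
    exact fun z hz => this hz
  have hpoly : ∀ z ∈ BooleanSubalgebra.closure s, ∃ p : BoolPoly ι,
      ∀ a ∉ T, a ∈ z.1 ↔ a ∈ p.eval b := by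
    intro z hz
    obtain ⟨p, hp⟩ := hclos z hz
    exact ⟨p, fun a ha => (mem_principal.1 hp.mem_iff) ha⟩
  refine ⟨S, ⟨?_, ?_, ?_⟩, isKFin_toStr hseq hA1 hT hC S rfl rfl rfl ?_ ?_⟩
  · exact fun a ha => Or.inl (Or.inl ha)
  · exact fun x hx => BooleanSubalgebra.subset_closure (Or.inr hx)
  · exact fun c hc => Or.inr hc
  · intro z hz a ha
    by_contra haT
    obtain ⟨p, hp⟩ := hpoly _ z.2
    refine hb.eval_infinite (p.nontrivial_of_mem_eval ((hp a haT).1 ha)) ?_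
    refine (hz.union hT).subset fun x hx => ?_
    by_cases hxT : x ∈ T
    · exact Or.inr hxT
    · exact Or.inl ((hp x hxT).2 hx)
  · intro z hz
    by_contra hinf
    obtain ⟨p, hp⟩ := hpoly _ z.2
    obtain ⟨a, ha, haT⟩ : ∃ a ∈ z.1.1, a ∉ T := by
      by_contra hcon
      push Not at hcon
      exact hinf (hT.subset hcon)
    obtain ⟨J, hJ⟩ := hb.exists_split ((hp a haT).1 ha)
    obtain ⟨n, hn⟩ : ∃ n, seq y0 n ∉ J := by
      by_contra hcon
      push Not at hcon
      exact infinite_univ ((J.finite_toSet.preimage (hinj y0).injOn).subset fun n _ => hcon n)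
    obtain ⟨h1, h2⟩ := hJ _ hn
    let w : BooleanSubalgebra.closure s := ⟨(setStr b seq).F n (.inl y0), S.F_mem n _ (Or.inl rfl)⟩
    obtain ⟨x, hx, hxT⟩ := h1.exists_notMem_finite hT
    obtain ⟨x', hx', hxT'⟩ := h2.exists_notMem_finite hT
    rcases hz.le_iff.1 (inf_le_left : z ⊓ w ≤ z) with h | h
    · have : x ∈ (z ⊓ w).1.1 := ⟨(hp x hxT).2 hx.1, hx.2⟩
      rw [h] at this
      exact this
    · have : x' ∈ (z ⊓ w).1.1 := by
        rw [h]
        exact (hp x' hxT').2 hx'.1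
      exact hx'.2 this.2

theorem exists_G_eq {x : polyAlg b cofinite} (hx : IsAtom x) :
    ∃ a, (setStr b seq).G a = x := by
  have hne : x.1.Nonempty := by
    by_contra hcon
    exact hx.1 (Subtype.ext (not_nonempty_iff_eq_empty.1 hcon))
  obtain ⟨a, ha⟩ := hne
  refine ⟨a, (hx.le_iff.1 (singleton_subset_iff.2 ha : ({a} : Set X) ⊆ x.1)).resolve_left ?_⟩
  exact fun h => singleton_ne_empty a (congrArg Subtype.val h)

theorem isAtom_G (a : X) : IsAtom ((setStr b seq).G a) := by
  refine ⟨fun h => singleton_ne_empty a (congrArg Subtype.val h), fun z hz => ?_⟩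
  have h' : z.1 ⊂ {a} := hz
  exact Subtype.ext (ssubset_singleton_iff.1 h')

theorem isAtomic : IsAtomic (setStr b seq).P1 := by
  refine ⟨fun x => or_iff_not_imp_left.2 fun hx => ?_⟩
  have hne : x.1.Nonempty := by
    by_contra hcon
    exact hx (Subtype.ext (not_nonempty_iff_eq_empty.1 hcon))
  obtain ⟨a, ha⟩ := hne
  exact ⟨_, isAtom_G (seq := seq) a, (singleton_subset_iff.2 ha : ({a} : Set X) ⊆ x.1)⟩

theorem mk_P1 (hX : ℵ₀ ≤ #X) (hι : #ι = #X) : #(polyAlg b cofinite) = #X := by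
  refine le_antisymm ?_ ?_
  · have key : ∀ x : polyAlg b cofinite, ∃ (p : BoolPoly ι) (f : Finset X),
        ∀ a, a ∉ f ↔ (a ∈ x.1 ↔ a ∈ p.eval b) := by
      rintro ⟨x, p, hp⟩
      have hp' := eventually_cofinite.1 hp.mem_iff
      refine ⟨p, hp'.toFinset, fun a => ?_⟩
      rw [Finite.mem_toFinset]
      exact not_not
    choose p f hpf using key
    let g : polyAlg b cofinite → BoolPoly ι × Finset X := fun x => (p x, f x)
    have hg : Function.Injective g := by
      intro x y hxy
      obtain ⟨h1, h2⟩ := Prod.ext_iff.1 hxy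
      dsimp only [g] at h1 h2
      ext a
      have h3 := hpf x a
      have h4 := hpf y a
      rw [h1, h2] at h3
      tauto
    have : Infinite X := infinite_iff.2 hX
    refine (mk_le_of_injective hg).trans ?_
    rw [mk_prod, lift_id, lift_id, mk_finset_of_infinite]
    refine mul_le_of_le hX ?_ le_rfl
    rw [← hι] at hX ⊢
    exact BoolPoly.mk_le hX
  · refine mk_le_of_injective (f := (setStr b (PEmpty.elim : PEmpty.{u + 1} → ℕ → ι)).G) ?_
    intro a a' h
    exact singleton_injective (congrArg Subtype.val h)

theorem isNicelyFree (hb : FinitelyDense b)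
    (hinj : ∀ y y' n n', seq y n = seq y' n' → y = y' ∧ n = n') (hX : ℵ₀ ≤ #X) (hι : #ι = #X)
    (hY : #Y = #X) : (setStr b seq).IsNicelyFree #X := by
  let b' : ι → polyAlg b cofinite := fun i => ⟨b i, gen_mem_polyAlg _ i⟩
  have heval : ∀ p : BoolPoly ι, (p.eval b').1 = p.eval b := fun p =>
    p.map_eval (polyAlg b cofinite).subtype b'
  have hind : IndependentMod (setStr b seq).P4 b' := by
    intro p hp hmem
    have h' : (p.eval b').1.Finite := hmem
    rw [heval] at h'
    exact hb.eval_infinite hp h'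
  refine ⟨mk_P1 hX hι, ι, b', hι, fun i => ?_, ⟨fun x => ?_, hind⟩, range Sum.inl, ?_, ?_, ?_⟩
  · exact hind (.var i) ⟨fun _ => true, by simp [BoolPoly.eval]⟩
  · obtain ⟨p, hp⟩ := x.2
    refine ⟨p, ?_⟩
    change (symmDiff x.1 (p.eval b').1).Finite
    rw [heval]
    refine Set.Finite.subset hp fun a ha hcon => ?_
    have hcon' : a ∈ x.1 ↔ a ∈ p.eval b := eq_iff_iff.1 hcon
    rw [mem_symmDiff] at ha
    tauto
  · rw [mk_range_eq _ Sum.inl_injective, hY]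
  · rintro _ ⟨y, rfl⟩ n
    exact ⟨seq y n, rfl⟩
  · rintro _ ⟨y, rfl⟩ _ ⟨y', rfl⟩ n n' h
    have h1 : b (seq y n) = b (seq y' n') := congrArg Subtype.val h
    have h2 : seq y n = seq y' n' := by
      classical
      by_contra hne
      obtain ⟨a, ha⟩ := (hb {seq y n, seq y' n'}
        (fun i => decide (i = seq y n))).nonempty
      have h3 := ha (seq y n) (by simp)
      have h4 := ha (seq y' n') (by simp)
      rw [h1] at h3
      simp only [decide_true, iff_true] at h3
      have := of_decide_eq_true (h4.1 h3)
      exact hne this.symm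
    obtain ⟨rfl, rfl⟩ := hinj _ _ _ _ h2
    exact ⟨rfl, rfl⟩

/-- `#X ^ ℵ₀ = #X` is needed to count all countable sequences of literals. -/
theorem mk_P2 (hX : ℵ₀ ≤ #X) (hXω : #X ^ ℵ₀ = #X) (hι : #ι = #X) (hY : #Y = #X) :
    #(Y ⊕ LiteralSeq b) = #X := by
  have : Infinite X := infinite_iff.2 hX
  have h1 : #(LiteralSeq b) ≤ #X := by
    refine (mk_subtype_le _).trans ?_
    have h2 : #(ℕ → ι × Bool) ≤ #X := by
      have h3 : #(ι × Bool) = #X := by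
        rw [mk_prod, lift_uzero, mk_bool, lift_ofNat, hι]
        exact mul_eq_left hX ((ofNat_lt_aleph0 (n := 2)).le.trans hX) two_ne_zero
      rw [mk_pi, prod_const, lift_uzero, h3, mk_nat, lift_aleph0, hXω]
    rw [mk_prod, lift_id, lift_id, mk_finset_of_infinite]
    exact mul_le_of_le hX h2 le_rfl
  rw [mk_sum, lift_id, lift_id, hY]
  exact add_eq_left hX h1

/-- An ultrafilter in `uf` determines a pattern of membership all of whose countable parts are
realized outside any finite set. -/
theorem exists_realized {D : Set (polyAlg b cofinite)} (hD : D ∈ (setStr b seq).uf)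
    (J : ℕ → ι) (f : Finset X) :
    ∃ a ∉ f, ∀ k, a ∈ b (J k) ↔ (⟨b (J k), gen_mem_polyAlg _ _⟩ : polyAlg b cofinite) ∈ D := by
  classical
  obtain ⟨hD1, hD2, hD3⟩ := hD
  by_contra! hcon
  let q : ι → Bool := fun i => decide ((⟨b i, gen_mem_polyAlg _ i⟩ : polyAlg b cofinite) ∈ D)
  let s : ℕ → ι × Bool := fun k => (J k, q (J k))
  have hs : ∀ a, a ∉ f → ∃ k, a ∉ literal b (s k) := by
    intro a ha
    obtain ⟨k, hk⟩ := hcon a ha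
    refine ⟨k, fun h => ?_⟩
    simp only [literal, s, q, mem_ofPred_eq, decide_eq_true_eq] at h
    tauto
  -- If the pattern is not realized off `f`, its literals meet only inside `f`, so they form an
  -- element of `P2`. All its `F n` will lie in `D`, contradicting `D ∈ uf`.
  let c : LiteralSeq b := ⟨(s, f), fun a ha => by
    by_contra haf
    obtain ⟨k, hk⟩ := hs a haf
    exact hk (ha k)⟩
  have hcompl : ∀ x : polyAlg b cofinite, xᶜ ∈ D ↔ x ∉ D := by
    intro x
    refine ⟨fun h h' => hD1.bot_notMem ?_, fun h => (hD1.mem_or_compl_mem x).resolve_left h⟩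
    simpa using hD1.inf_mem _ _ h' h
  have hlit : ∀ k, (⟨literal b (s k), literal_mem_polyAlg _ _⟩ : polyAlg b cofinite) ∈ D := by
    intro k
    by_cases hk : (⟨b (J k), gen_mem_polyAlg _ (J k)⟩ : polyAlg b cofinite) ∈ D
    · convert hk using 2
      ext a
      simp [literal, s, q, hk]
    · have := (hcompl _).2 hk
      convert this using 1
      ext a
      simp [literal, s, q, hk]
  have hinit : ∀ n, (⟨initInter b s n, initInter_mem_polyAlg _ _ _⟩ : polyAlg b cofinite) ∈ D := by
    intro n
    induction n with
    | zero =>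
      convert hlit 0 using 2
      ext; simp [initInter]
    | succ n ih =>
      convert hD1.inf_mem _ _ ih (hlit (n + 1)) using 1
      ext a
      simp [initInter, Nat.le_succ_iff, or_imp, forall_and]
  have hfin : ∀ g : Finset X, ∃ h, (⟨(g : Set X)ᶜ, h⟩ : polyAlg b cofinite) ∈ D := by
    intro g
    induction g using Finset.induction_on with
    | empty =>
      refine ⟨BooleanSubalgebra.compl_mem (finite_mem_polyAlg (Finset.finite_toSet _)), ?_⟩
      convert hD1.top_mem using 1
      ext; simp
    | insert a g _ ih =>
      obtain ⟨h, ih⟩ := ih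
      refine ⟨BooleanSubalgebra.compl_mem (finite_mem_polyAlg (Finset.finite_toSet _)), ?_⟩
      have ha : (setStr b seq).G a ∉ D := fun ha =>
        (eq_empty_iff_forall_notMem.1 hD2) _ ⟨ha, TauStr.mem_P4n_one.2 (isAtom_G a)⟩
      convert hD1.inf_mem _ _ ((hcompl _).2 ha) ih using 1
      ext; simp
  refine infinite_univ ((hD3 (.inr c)).subset fun n _ => ?_)
  obtain ⟨h, hf⟩ := hfin f
  exact hD1.inf_mem _ _ (hinit n) hf

end setStr

/-! ### Coding ultrafilters by first differences -/

section Coding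

variable {m : Type u}

variable (m) in
/-- The index set of the generators. -/
abbrev GenIndex : Type u := (m ⊕ (Set m × Set m)) × ℕ

/-- The sequences of generators which contain each point only finitely often. -/
def nullSeq (q : Set m) (n : ℕ) : GenIndex m := (.inr (q, ∅), n)

theorem nullSeq_inj (q q' : Set m) (n n' : ℕ) (h : nullSeq q n = nullSeq q' n') :
    q = q' ∧ n = n' := by
  simpa [nullSeq] using h

variable [LinearOrder m]

/-- The points are the subsets of `m`; besides the coordinate sets, we use for each point `q` and
each `s` the set of points whose first difference with `q` lies in `s`. -/
def cell : m ⊕ (Set m × Set m) → Set (Set m)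
  | .inl i => {x | i ∈ x}
  | .inr (q, s) => {x | ∃ i ∈ s, ¬ (i ∈ x ↔ i ∈ q) ∧ ∀ j < i, (j ∈ x ↔ j ∈ q)}

/-- Finite perturbations of infinitely many copies of the sets `cell i`, governed by a coding `w`
of finite partial functions by points. -/
def gen (w : Set m → Finset (GenIndex m) × Finset (GenIndex m) × ℕ) (i : GenIndex m) :
    Set (Set m) :=
  {a | i ∈ (w a).1 ∨ (i ∉ (w a).2.1 ∧ a ∈ cell i.1)}

variable {w : Set m → Finset (GenIndex m) × Finset (GenIndex m) × ℕ}

/-- Some point has as its overrides exactly the prescribed pattern on `J`; the free natural number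
in the code yields infinitely many such points. -/
theorem finitelyDense_gen (hw : Function.Surjective w) : FinitelyDense (gen w) := by
  classical
  intro J v
  choose a ha using fun k : ℕ => hw (J.filter fun i => v i = true, J.filter fun i => v i = false, k)
  refine infinite_of_injective_forall_mem (f := a) (fun k k' h => ?_) fun k i hi => ?_
  · have := (ha k).symm.trans ((congrArg w h).trans (ha k'))
    simpa using this
  · simp only [gen, mem_ofPred_eq, ha, Finset.mem_filter, hi, true_and]
    cases v i <;> simp

/-- The point `a` overrides only the finitely many generators listed in `w a`. -/
theorem eventually_mem_gen_iff (i : m ⊕ (Set m × Set m)) (a : Set m) :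
    ∀ᶠ n in atTop, a ∈ gen w (i, n) ↔ a ∈ cell i := by
  classical
  have h1 := ((w a).1 ∪ (w a).2.1).finite_toSet.preimage (f := fun n : ℕ => (i, n))
    (fun _ _ _ _ h => (Prod.ext_iff.1 h).2)
  rw [← Nat.cofinite_eq_atTop]
  filter_upwards [h1.compl_mem_cofinite] with n hn
  simp only [mem_compl_iff, mem_preimage, Finset.coe_union, mem_union, Finset.mem_coe, not_or]
    at hn
  simp [gen, hn.1, hn.2]

theorem finite_mem_nullSeq (a q : Set m) : {n | a ∈ gen w (nullSeq q n)}.Finite := by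
  have h := eventually_mem_gen_iff (w := w) (.inr (q, ∅)) a
  rw [← Nat.cofinite_eq_atTop] at h
  refine Set.Finite.subset h fun n hn hcon => ?_
  have := hcon.1 hn
  simp [cell] at this

theorem first_diff_unique {a q : Set m} {i i' : m}
    (h : ¬ (i ∈ a ↔ i ∈ q) ∧ ∀ j < i, (j ∈ a ↔ j ∈ q))
    (h' : ¬ (i' ∈ a ↔ i' ∈ q) ∧ ∀ j < i', (j ∈ a ↔ j ∈ q)) : i = i' := by
  rcases lt_trichotomy i i' with hlt | heq | hlt
  · exact absurd (h'.2 _ hlt) h.1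
  · exact heq
  · exact absurd (h.2 _ hlt) h'.1

theorem mem_cell_iff_of_first_diff {a q : Set m} {i : m}
    (h : ¬ (i ∈ a ↔ i ∈ q) ∧ ∀ j < i, (j ∈ a ↔ j ∈ q)) (s : Set m) :
    a ∈ cell (.inr (q, s)) ↔ i ∈ s :=
  ⟨fun ⟨_, hi', h'⟩ => first_diff_unique h h' ▸ hi', fun hi => ⟨i, hi, h⟩⟩

variable [WellFoundedLT m]

theorem mem_cell_univ {a q : Set m} (h : a ≠ q) : a ∈ cell (.inr (q, univ)) := by
  have hne : {i | ¬ (i ∈ a ↔ i ∈ q)}.Nonempty := by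
    by_contra hcon
    rw [not_nonempty_iff_eq_empty] at hcon
    refine h (Set.ext fun i => ?_)
    by_contra hi
    exact (eq_empty_iff_forall_notMem.1 hcon) i hi
  refine ⟨WellFounded.min wellFounded_lt _ hne, mem_univ _, WellFounded.min_mem _ _ hne,
    fun j hj => ?_⟩
  by_contra hcon
  exact WellFounded.not_lt_min _ _ hcon hj

/-- A pattern of membership in the cells all of whose countable parts are realized outside any
finite set induces a countably complete ultrafilter without singletons on `m`. -/
theorem exists_ultrafilter_of_realized (P : m ⊕ (Set m × Set m) → Prop)
    (hP : ∀ (J : ℕ → m ⊕ (Set m × Set m)) (f : Finset (Set m)),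
      ∃ a ∉ f, ∀ k, a ∈ cell (J k) ↔ P (J k)) :
    ∃ U : Ultrafilter m, (∀ A : ℕ → Set m, (∀ k, A k ∈ U) → (⋂ k, A k) ∈ U) ∧
      ∀ i : m, ({i} : Set m) ∉ U := by
  -- The point that the pattern describes on coordinates. Realizing points are taken different from
  -- it, so a first difference exists.
  let q : Set m := {i | P (.inl i)}
  have key : ∀ (A : ℕ → Set m) (i₀ : m), ∃ i, (∀ k, i ∈ A k ↔ P (.inr (q, A k))) ∧ i ≠ i₀ := by
    intro A i₀
    -- Position `0` makes `a` agree with `q` at `i₀`, so the first difference is not `i₀`; the sets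
    -- `A k` are shifted by one.
    obtain ⟨a, ha, hak⟩ := hP (fun k => k.casesOn (.inl i₀) fun k => .inr (q, A k)) {q}
    obtain ⟨i, -, hi⟩ := mem_cell_univ (a := a) (q := q) (by simpa using ha)
    refine ⟨i, fun k => ?_, ?_⟩
    · rw [← mem_cell_iff_of_first_diff hi]
      exact hak (k + 1)
    · rintro rfl
      exact hi.1 (hak 0)
  have key' : ∀ A : ℕ → Set m, ∃ i, ∀ k, i ∈ A k ↔ P (.inr (q, A k)) := by
    intro A
    obtain ⟨a, ha, hak⟩ := hP (fun k => .inr (q, A k)) {q}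
    obtain ⟨i, -, hi⟩ := mem_cell_univ (a := a) (q := q) (by simpa using ha)
    refine ⟨i, fun k => ?_⟩
    rw [← mem_cell_iff_of_first_diff hi]
    exact hak k
  have hinter : ∀ A : ℕ → Set m, (∀ k, P (.inr (q, A k))) → P (.inr (q, ⋂ k, A k)) := by
    intro A hA
    obtain ⟨i, hi⟩ := key' fun k => k.casesOn (⋂ k, A k) A
    exact (hi 0).1 (mem_iInter.2 fun k => (hi (k + 1)).2 (hA k))
  have hsup : ∀ s t : Set m, P (.inr (q, s)) → s ⊆ t → P (.inr (q, t)) := by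
    intro s t hs hst
    obtain ⟨i, hi⟩ := key' fun k => k.casesOn s fun _ => t
    exact (hi 1).1 (hst ((hi 0).2 hs))
  let F : Filter m :=
    { sets := {s | P (.inr (q, s))}
      univ_sets := by
        obtain ⟨i, hi⟩ := key' fun _ => univ
        exact (hi 0).1 (mem_univ i)
      sets_of_superset := fun {s t} hs hst => hsup s t hs hst
      inter_sets := by
        intro s t hs ht
        refine hsup _ _ (hinter (fun k => k.casesOn s fun _ => t) ?_) ?_
        · rintro (_ | k)
          exacts [hs, ht]
        · exact fun x hx => ⟨mem_iInter.1 hx 0, mem_iInter.1 hx 1⟩ }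
  have hF : ∀ s, sᶜ ∉ F ↔ s ∈ F := by
    intro s
    obtain ⟨i, hi⟩ := key' fun k => k.casesOn s fun _ => sᶜ
    exact (not_congr (hi 1)).symm.trans (not_not.trans (hi 0))
  refine ⟨Ultrafilter.ofComplNotMemIff F hF, hinter, fun i₀ hi₀ => ?_⟩
  obtain ⟨i, hi, hne⟩ := key (fun _ => {i₀}) i₀
  exact hne ((hi 0).2 hi₀)

theorem uf_setStr_gen_eq_empty {lam : Cardinal.{u}} (hm : #m ≤ lam)
    (hmeas : BelowFirstMeasurable lam) : (setStr (gen w) nullSeq).uf = ∅ := by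
  rw [eq_empty_iff_forall_notMem]
  intro D hD
  let p : GenIndex m → Prop := fun i =>
    (⟨gen w i, gen_mem_polyAlg _ _⟩ : polyAlg (gen w) cofinite) ∈ D
  obtain ⟨U, hU, hU'⟩ := exists_ultrafilter_of_realized (m := m)
    (fun i => ∀ᶠ n in atTop, p (i, n)) fun J f => by
      obtain ⟨a, ha, hak⟩ := setStr.exists_realized hD
        -- Unpairing enumerates all copies of all the cells `J k`, so one point realizes them
        -- simultaneously; its eventual membership is constant, which decides the eventual pattern
        -- of `D`.
        (fun k => (J k.unpair.1, k.unpair.2)) f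
      refine ⟨a, ha, fun k => ?_⟩
      have h1 : ∀ᶠ n in atTop, p (J k, n) ↔ a ∈ cell (J k) := by
        filter_upwards [eventually_mem_gen_iff (w := w) (J k) a] with n hn
        have := hak (Nat.pair k n)
        rw [Nat.unpair_pair] at this
        exact this.symm.trans hn
      rw [eventually_congr h1, eventually_const]
  obtain ⟨κ, hκ, hκm⟩ := exists_isMeasurableCardinal_le U hU hU'
  exact absurd (hmeas κ hκ) (not_lt.2 (hκm.trans hm))

end Coding

/-! ### Cardinal arithmetic and conclusion -/

theorem mainTheorem3 (mu lam : Cardinal.{u}) (hmu : Cardinal.aleph0 ≤ mu)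
    (hlam : lam = 2 ^ mu) (hmeas : BelowFirstMeasurable lam) :
    ∃ M : TauStr.{u},
      M.IsP0Maximal ∧
      Cardinal.mk M.P0 = lam ∧ Cardinal.mk M.P1 = lam ∧ Cardinal.mk M.P2 = lam ∧
      IsAtomic M.P1 ∧
      M.uf = ∅ ∧
      M.IsNicelyFree lam := by
  let m : Type u := mu.ord.ToType
  have hm : #m = mu := mk_ord_toType mu
  have hX : #(Set m) = lam := by rw [mk_set, hm, hlam]
  have hmlam : #m ≤ lam := by rw [hm, hlam]; exact (cantor mu).le
  have hXinf : ℵ₀ ≤ #(Set m) := (hmu.trans (hm ▸ hmlam)).trans hX.ge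
  -- This is where `lam` being a power `2 ^ mu` matters.
  have hXω : #(Set m) ^ ℵ₀ = #(Set m) := by
    rw [hX, hlam, ← power_mul, mul_eq_left hmu hmu aleph0_ne_zero]
  have hι : #(GenIndex m) = #(Set m) := by
    have h1 : #(m ⊕ (Set m × Set m)) = #(Set m) := by
      rw [mk_sum, lift_id, lift_id, mk_prod, lift_id, mul_eq_self hXinf]
      exact add_eq_right hXinf (hX ▸ hmlam)
    rw [mk_prod, lift_uzero, h1, mk_nat, lift_aleph0]
    exact mul_eq_left hXinf hXinf aleph0_ne_zero
  obtain ⟨w, hw⟩ : ∃ w : Set m → Finset (GenIndex m) × Finset (GenIndex m) × ℕ,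
      Function.Surjective w := by
    have hinf : Infinite (GenIndex m) := infinite_iff.2 (hι ▸ hXinf)
    have h1 : #(Finset (GenIndex m) × Finset (GenIndex m) × ℕ) = #(Set m) := by
      rw [mk_prod, mk_prod, lift_uzero, mk_nat, lift_aleph0, lift_id, lift_id,
        mk_finset_of_infinite, hι, mul_eq_left hXinf hXinf aleph0_ne_zero, mul_eq_self hXinf]
    obtain ⟨e⟩ := Cardinal.eq.1 h1.symm
    exact ⟨e, e.surjective⟩
  have hdense := finitelyDense_gen hw
  have huf := uf_setStr_gen_eq_empty (w := w) hmlam hmeas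
  have hK : (setStr (gen w) nullSeq).IsK := setStr.isK hdense finite_mem_nullSeq
    fun q n n' h => (nullSeq_inj q q n n' h).2
  refine ⟨setStr (gen w) nullSeq, ?_, hX, ?_, ?_, setStr.isAtomic, huf, ?_⟩
  · exact TauStr.isP0Maximal_of_uf_eq_empty hK
      (fun b hb => setStr.exists_G_eq (TauStr.mem_P4n_one.1 hb)) huf
  · exact (setStr.mk_P1 hXinf hι).trans hX
  · exact (setStr.mk_P2 hXinf hXω hι rfl).trans hX
  · rw [← hX]
    exact setStr.isNicelyFree hdense (fun q q' n n' h => nullSeq_inj q q' n n' h) hXinf hι rfl
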